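/- **Pivot orderings.** Let $\mathcal P_n=\{(i,j):1\le i<j\le n\}$ and let $\mathcal O(\mathcal P_n)$ be the set of all finite sequences of elements of $\mathcal P_n$ in which every element of $\mathcal P_n$ appears at least once. For $\mathcal O,\mathcal O'\in\mathcal O(\mathcal P_n)$: - $\mathcal O\sim\mathcal O'$ if $\mathcal O'$ is obtained from $\mathcal O$ by finitely many admissible transpositions, i.e. swaps of two adjacent pairs $(i,j),(i',j')$ with $\{i,j\}\cap\{i',j'\}=\emptyset$; - $\mathcal O\overset{s}{\sim}\mathcal O'$ if $\mathcal O=[\mathcal O_1,\mathcal O_2]$ and $\mathcal O'=[\mathcal O_2,\mathcal O_1]$ for some (possibly empty) sequences $\mathcal O_1,\mathcal O_2$; - $\mathcal O\overset{w}{\sim}\mathcal O'$ if there is a finite chain $\mathcal O=\mathcal O_0,\mathcal O_1,\dots,\mathcal O_t=\mathcal O'$ in $\mathcal O(\mathcal P_n)$ in which any two adjacent terms are related by $\sim$ or $\overset{s}{\sim}$; - $\mathcal O\overset{p}{\sim}\mathcal O'$ if $\mathcal O'$ is obtained from $\mathcal O$ by replacing every pair $(i,j)$ with the pair formed by $\sigma(i),\sigma(j)$,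 smaller index first, for one permutation $\sigma$ of $\{1,\dots,n\}$. Let $\mathcal C_c^{(n)}$ be the set of the orderings $(1,2),(\tau_3(1),3),(\tau_3(2),3),\dots,(\tau_n(1),n),\dots,(\tau_n(n-1),n)$, where each $\tau_j$ is a permutation of $\{1,\dots,j-1\}$. Let $\mathcal C_r^{(n)}$ be the set of the orderings $(n-1,n),(n-2,\tau_{n-2}(n-1)),(n-2,\tau_{n-2}(n)),\dots,(1,\tau_1(2)),\dots,(1,\tau_1(n))$, where each $\tau_i$ is a permutation of $\{i+1,\dots,n\}$. Let $\mathcal C_{sp}^{(n)}$ consist of the elements of $\mathcal C_c^{(n)}\cup\mathcal C_r^{(n)}$ and their reverses. Finally, $\mathcal C_{sg}^{(n)}$ is the set of all $\mathcal O\in\mathcal O(\mathcal P_n)$ for which there are $\mathcal O'\in\mathcal O(\mathcal P_n)$ and $\mathcal O''\in\mathcal C_{sp}^{(n)}$ with $\mathcal O\overset{w}{\sim}\mathcal O'\overset{p}{\sim}\mathcal O''$ or $\mathcal O\overset{p}{\sim}\mathcal O'\overset{w}{\sim}\mathcal O''$. **Off-norm.** For $X\in\mathbb C^{n\times n}$ let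 $\mathrm{off}(X)=\big(\sum_{i\ne j}|x_{ij}|^2\big)^{1/2}$. **Proposition 4.3.** Let $n\geq 2$, and let the pivot pairs $(p(k),q(k))$, $k\ge0$, run cyclically through an ordering $\mathcal O\in\mathcal C_{sg}^{(n)}$, that is, $(p(k),q(k))$ is the term of $\mathcal O$ with (zero-based) index $k$ modulo the length of $\mathcal O$. Let $H\in\mathbb C^{n\times n}$ be Hermitian, and let $$H^{(0)}=H,\qquad H^{(k+1)}=R_k^*H^{(k)}R_k+M^{(k)},\quad k\ge0,$$ where the matrices $M^{(k)}\in\mathbb C^{n\times n}$ are Hermitian and $R_k$ is a complex plane rotation in the $(p,q)=(p(k),q(k))$ plane with angle $|\varphi_k|\le\pi/4$: it equals the identity matrix except for the entries $(R_k)_{pp}=(R_k)_{qq}=\cos\varphi_k$, $(R_k)_{pq}=-e^{\imath\alpha_k}\sin\varphi_k$ and $(R_k)_{qp}=e^{-\imath\alpha_k}\sin\varphi_k$, with arbitrary $\alpha_k\in\mathbb R$. Suppose that $\lim_{k\to\infty}\mathrm{off}(M^{(k)})=0$. If $$\lim_{k\to\infty}\big|h^{(k+1)}_{p(k)q(k)}\big|=0,$$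 then $$\lim_{k\to\infty}\mathrm{off}(H^{(k)})=0.$$ -/

import Mathlib

open Filter Topology

namespace JacobiPivot

/-- `𝓞(𝓟ₙ)`: the finite sequences of pivot pairs `(i, j)`, `i < j`, in which each of these pairs
appears at least once. Indices `1, …, n` are represented by `Fin n`. -/
def orderings (n : ℕ) : Set (List (Fin n × Fin n)) :=
  {O | (∀ x ∈ O, x.1 < x.2) ∧ ∀ i j : Fin n, i < j → (i, j) ∈ O}

/-- `O'` arises from `O` by one admissible transposition: two adjacent pairs with disjoint
underlying index sets are swapped. -/
def AdmissibleTransposition {n : ℕ} (O O' : List (Fin n × Fin n)) : Prop :=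
  ∃ (L₁ L₂ : List (Fin n × Fin n)) (a b : Fin n × Fin n),
    Disjoint ({a.1, a.2} : Set (Fin n)) {b.1, b.2} ∧
      O = L₁ ++ a :: b :: L₂ ∧ O' = L₁ ++ b :: a :: L₂

/-- `O ∼ O'`: finitely many admissible transpositions lead from `O` to `O'`. -/
def Equivalent {n : ℕ} (O O' : List (Fin n × Fin n)) : Prop :=
  Relation.ReflTransGen AdmissibleTransposition O O'

/-- Shift-equivalence: `O = [O₁, O₂]` and `O' = [O₂, O₁]`. -/
def ShiftEquivalent {n : ℕ} (O O' : List (Fin n × Fin n)) : Prop :=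
  ∃ O₁ O₂ : List (Fin n × Fin n), O = O₁ ++ O₂ ∧ O' = O₂ ++ O₁

/-- Weak equivalence: a finite chain of orderings from `O` to `O'` in which adjacent terms are
equivalent or shift-equivalent. -/
def WeakEquivalent {n : ℕ} (O O' : List (Fin n × Fin n)) : Prop :=
  Relation.ReflTransGen
    (fun A B => A ∈ orderings n ∧ B ∈ orderings n ∧ (Equivalent A B ∨ ShiftEquivalent A B)) O O'

/-- Permutation equivalence: the indices in `O` are relabelled by a permutation `σ`. As a pivot
pair, `{σ i, σ j}` is written with its smaller element first. -/
def PermutationEquivalent {n : ℕ} (O O' : List (Fin n × Fin n)) : Prop :=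
  ∃ σ : Equiv.Perm (Fin n),
    O' = O.map fun x => (min (σ x.1) (σ x.2), max (σ x.1) (σ x.2))

/-- The permutations of the subset `s` of the index set (extended by the identity off `s`). -/
def permsOf {n : ℕ} (s : Set (Fin n)) : Set (Equiv.Perm (Fin n)) :=
  {τ | ∀ i ∉ s, τ i = i}

/-- Column by column from left to right; column `j` is passed in the order
`(τ j 1, j), …, (τ j (j - 1), j)`. -/
def columnOrdering {n : ℕ} (τ : Fin n → Equiv.Perm (Fin n)) : List (Fin n × Fin n) :=
  (List.finRange n).flatMap fun j =>
    ((List.finRange n).filter (· < j)).map fun i => (τ j i, j)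

/-- Row by row from bottom to top; row `i` is passed in the order
`(i, τ i (i + 1)), …, (i, τ i n)`. -/
def rowOrdering {n : ℕ} (τ : Fin n → Equiv.Perm (Fin n)) : List (Fin n × Fin n) :=
  (List.finRange n).reverse.flatMap fun i =>
    ((List.finRange n).filter (i < ·)).map fun j => (i, τ i j)

/-- Column-wise orderings with permutations. -/
def columnwise (n : ℕ) : Set (List (Fin n × Fin n)) :=
  {O | O ∈ orderings n ∧ ∃ τ : Fin n → Equiv.Perm (Fin n),
    (∀ j, τ j ∈ permsOf (Set.Iio j)) ∧ O = columnOrdering τ}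

/-- Row-wise orderings with permutations. -/
def rowwise (n : ℕ) : Set (List (Fin n × Fin n)) :=
  {O | O ∈ orderings n ∧ ∃ τ : Fin n → Equiv.Perm (Fin n),
    (∀ i, τ i ∈ permsOf (Set.Ioi i)) ∧ O = rowOrdering τ}

/-- Serial orderings with permutations: the column-wise and row-wise ones and their reverses. -/
def serialPerm (n : ℕ) : Set (List (Fin n × Fin n)) :=
  {O | O ∈ columnwise n ∨ O.reverse ∈ columnwise n ∨ O ∈ rowwise n ∨ O.reverse ∈ rowwise n}

/-- Generalized serial orderings with permutations. -/
def generalizedSerial (n : ℕ) : Set (List (Fin n × Fin n)) :=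
  {O | O ∈ orderings n ∧ ∃ O' ∈ orderings n, ∃ O'' ∈ serialPerm n,
    (WeakEquivalent O O' ∧ PermutationEquivalent O' O'') ∨
      (PermutationEquivalent O O' ∧ WeakEquivalent O' O'')}

/-- `I` is the cyclic pivot strategy defined by `O`: it runs through `O` periodically. -/
def IsCyclicStrategy {n : ℕ} (O : List (Fin n × Fin n)) (I : ℕ → Fin n × Fin n) : Prop :=
  ∀ k, O[k % O.length]? = some (I k)

/-- The complex plane rotation in the `(p, q)` plane with rotation angle `φ`: it equals the identity
except for its `(p, q)` submatrix `[cos φ, -e^{iα} sin φ; e^{-iα} sin φ, cos φ]`. -/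
noncomputable def planeRotation {n : ℕ} (p q : Fin n) (α φ : ℝ) : Matrix (Fin n) (Fin n) ℂ :=
  Matrix.of fun i j =>
    if i = p ∧ j = p then (Real.cos φ : ℂ)
    else if i = p ∧ j = q then -(Complex.exp (Complex.I * α) * (Real.sin φ : ℂ))
    else if i = q ∧ j = p then Complex.exp (-(Complex.I * α)) * (Real.sin φ : ℂ)
    else if i = q ∧ j = q then (Real.cos φ : ℂ)
    else if i = j then 1 else 0

/-- The off-norm: the Frobenius norm of the off-diagonal part. -/
noncomputable def off {n : ℕ} (X : Matrix (Fin n) (Fin n) ℂ) : ℝ :=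
  Real.sqrt (∑ i, ∑ j, if i = j then 0 else ‖X i j‖ ^ 2)

end JacobiPivot

/-!
The diagonal of a Hermitian matrix does not enter the evolution of its off-diagonal entries other
than through the pivot entry. Hence, up to an error made of `M` and of the new pivot entry, which
tends to zero by assumption, the off-diagonal part `A` of `H` evolves by the *Jacobi step*
`jacobiStep`: annihilate the pivot entries of `A`, then apply the unitary congruence by the rotation
(`norm_offDiag_sub_jacobiStep_apply_le`). A Jacobi step is linear and does not increase the Frobenius
norm, so it suffices that finitely many cycles of Jacobi steps contract by a factor `γ < 1`
independent of the rotations (`tendsto_zero_of_periodic`).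

The rotations with angle in `[-π/4, π/4]` form a compact set. By compactness, uniform contraction
follows once a nonzero matrix with zero diagonal cannot keep its norm (`exists_contraction`). The norm
is kept only if every pivot entry is already zero when its turn comes; such a sequence of steps is
called a *lossless run* here, and a list of pivot pairs is *forcing* if only the zero matrix admits a
lossless run through it.

Column-wise orderings are forcing (`forcing_of_columns`): if the leading block before column `j` is
zero, then each rotation in column `j` multiplies the entries of this column that are still to be
visited by `cos φ ≠ 0`. As these entries are zero when visited, they were zero from the beginning, and
the leading block grows. Lossless runs can be read backwards, relabelled by a permutation of the
indices, and rearranged by swapping steps with disjoint pivot pairs; a cyclic shift costs one further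
cycle. So the property that some number of cycles is forcing passes from the column-wise orderings to
all generalized serial ones (`eventuallyForcing_of_mem_generalizedSerial`).
-/

namespace JacobiPivot

open Matrix

variable {n : ℕ}

/-! ### Plane rotations and the congruence they induce -/

/-- The matrix of a complex plane rotation in the `(p, q)` plane, parametrised by `u = (c, w)`: its
`(p, q)` submatrix is `[c, -w; w̄, c]`. With `c = cos φ` and `w = e^{iα} sin φ` this is
`planeRotation p q α φ`; the pair `(c, w)` has the advantage of ranging over a compact set, whereas
`α` does not. -/
def pivotUnitary (p q : Fin n) (u : ℝ × ℂ) : Matrix (Fin n) (Fin n) ℂ :=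
  Matrix.of fun i j =>
    if i = p ∧ j = p then (u.1 : ℂ)
    else if i = p ∧ j = q then -u.2
    else if i = q ∧ j = p then star u.2
    else if i = q ∧ j = q then (u.1 : ℂ)
    else if i = j then 1 else 0

/-- The parameters `(c, w)` of the rotations with angle in `[-π/4, π/4]`. -/
def angleParams : Set (ℝ × ℂ) := {u | √2 / 2 ≤ u.1 ∧ u.1 ^ 2 + ‖u.2‖ ^ 2 = 1}

lemma angleParams_ne_zero {u : ℝ × ℂ} (hu : u ∈ angleParams) : (u.1 : ℂ) ≠ 0 := by
  have h : (0 : ℝ) < √2 / 2 := by positivity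
  exact_mod_cast (h.trans_le hu.1).ne'

lemma angleParams_mul_add {u : ℝ × ℂ} (hu : u ∈ angleParams) :
    (u.1 : ℂ) * u.1 + u.2 * star u.2 = 1 := by
  have h := hu.2
  have h2 : u.2 * star u.2 = ((‖u.2‖ ^ 2 : ℝ) : ℂ) := by
    rw [Complex.star_def, Complex.mul_conj, Complex.normSq_eq_norm_sq]
  rw [h2]
  exact_mod_cast (by linear_combination h : u.1 * u.1 + ‖u.2‖ ^ 2 = 1)

lemma neg_mem_angleParams {u : ℝ × ℂ} (hu : u ∈ angleParams) : (u.1, -u.2) ∈ angleParams := by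
  simpa [angleParams] using hu

lemma neg_star_mem_angleParams {u : ℝ × ℂ} (hu : u ∈ angleParams) :
    (u.1, -star u.2) ∈ angleParams := by
  simpa [angleParams] using hu

/-- Exchanging the roles of `p` and `q` only changes the parameter of the rotation. This is what
allows pivot pairs to be rewritten with the smaller index first after a relabelling. -/
lemma pivotUnitary_swap {p q : Fin n} (hpq : p ≠ q) (u : ℝ × ℂ) :
    pivotUnitary q p (u.1, -star u.2) = pivotUnitary p q u := by
  ext i j
  simp only [pivotUnitary, of_apply]
  grind [star_neg, star_star]

lemma pivotUnitary_conjTranspose {p q : Fin n} (hpq : p ≠ q) (u : ℝ × ℂ) :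
    (pivotUnitary p q u)ᴴ = pivotUnitary p q (u.1, -u.2) := by
  have h : star (u.1 : ℂ) = u.1 := Complex.conj_ofReal _
  ext i j
  simp only [pivotUnitary, of_apply, conjTranspose_apply, apply_ite star, star_neg, star_star,
    star_one, star_zero, h, neg_neg]
  grind

lemma planeRotation_eq_pivotUnitary (p q : Fin n) (α φ : ℝ) :
    planeRotation p q α φ =
      pivotUnitary p q (Real.cos φ, Complex.exp (Complex.I * α) * (Real.sin φ : ℂ)) := by
  have h : star (Complex.exp (Complex.I * α) * (Real.sin φ : ℂ)) =
      Complex.exp (-(Complex.I * α)) * (Real.sin φ : ℂ) := by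
    rw [Complex.star_def, map_mul, Complex.conj_ofReal, ← Complex.exp_conj, map_mul,
      Complex.conj_I, Complex.conj_ofReal, neg_mul]
  simp only [planeRotation, pivotUnitary, h]

lemma rotation_mem_angleParams (α : ℝ) {φ : ℝ} (hφ : |φ| ≤ Real.pi / 4) :
    (Real.cos φ, Complex.exp (Complex.I * α) * (Real.sin φ : ℂ)) ∈ angleParams := by
  refine ⟨?_, ?_⟩
  · rw [← Real.cos_pi_div_four, ← Real.cos_abs φ]
    exact Real.cos_le_cos_of_nonneg_of_le_pi (abs_nonneg _) (by linarith [Real.pi_pos]) hφ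
  · simp only [norm_mul, mul_comm Complex.I, Complex.norm_exp_ofReal_mul_I, one_mul,
      Complex.norm_real, Real.norm_eq_abs, sq_abs, Real.cos_sq_add_sin_sq]

lemma mul_pivotUnitary_apply {p q : Fin n} (hpq : p ≠ q) (u : ℝ × ℂ)
    (A : Matrix (Fin n) (Fin n) ℂ) (i j : Fin n) :
    (A * pivotUnitary p q u) i j =
      if j = p then A i p * u.1 + A i q * star u.2
      else if j = q then -(A i p * u.2) + A i q * u.1 else A i j := by
  rw [mul_apply]
  split_ifs with h1 h2
  · subst h1
    rw [Finset.sum_eq_add j q hpq]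
    · simp [pivotUnitary, hpq.symm]
    · rintro c - ⟨h, h'⟩
      simp [pivotUnitary, h, h']
    · simp
    · simp
  · subst h2
    rw [Finset.sum_eq_add p j hpq]
    · simp [pivotUnitary, hpq.symm]
    · rintro c - ⟨h, h'⟩
      simp [pivotUnitary, h, h']
    · simp
    · simp
  · rw [Finset.sum_eq_single j]
    · simp [pivotUnitary, h1, h2]
    · intro b _ hb
      simp [pivotUnitary, h1, h2, hb]
    · simp

/-- The unitary congruence `A ↦ Uᴴ A U` by a plane rotation `U`. -/
def rotate (p q : Fin n) (u : ℝ × ℂ) (A : Matrix (Fin n) (Fin n) ℂ) : Matrix (Fin n) (Fin n) ℂ :=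
  (pivotUnitary p q u)ᴴ * A * pivotUnitary p q u

lemma conjTranspose_rotate (p q : Fin n) (u : ℝ × ℂ) (A : Matrix (Fin n) (Fin n) ℂ) :
    (rotate p q u A)ᴴ = rotate p q u Aᴴ := by
  simp [rotate, Matrix.mul_assoc]

lemma conjTranspose_pivotUnitary_mul_apply {p q : Fin n} (hpq : p ≠ q) (u : ℝ × ℂ)
    (A : Matrix (Fin n) (Fin n) ℂ) (i j : Fin n) :
    ((pivotUnitary p q u)ᴴ * A) i j =
      if i = p then u.1 * A p j + u.2 * A q j
      else if i = q then -(star u.2 * A p j) + u.1 * A q j else A i j := by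
  have h : (pivotUnitary p q u)ᴴ * A = (Aᴴ * pivotUnitary p q u)ᴴ := by simp
  rw [h, conjTranspose_apply, mul_pivotUnitary_apply hpq]
  split_ifs <;> simp [mul_comm]

lemma pivotUnitary_mul_conjTranspose {p q : Fin n} (hpq : p ≠ q) {u : ℝ × ℂ}
    (hu : u ∈ angleParams) : pivotUnitary p q u * (pivotUnitary p q u)ᴴ = 1 := by
  have h := angleParams_mul_add hu
  ext i j
  rw [pivotUnitary_conjTranspose hpq, mul_pivotUnitary_apply hpq]
  simp only [pivotUnitary, of_apply, one_apply, star_neg]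
  grind

lemma rotate_apply {p q : Fin n} (hpq : p ≠ q) (u : ℝ × ℂ) (A : Matrix (Fin n) (Fin n) ℂ)
    {i j : Fin n} (hip : i ≠ p) (hiq : i ≠ q) (hjp : j ≠ p) (hjq : j ≠ q) :
    rotate p q u A i j = A i j := by
  rw [rotate, mul_pivotUnitary_apply hpq, if_neg hjp, if_neg hjq,
    conjTranspose_pivotUnitary_mul_apply hpq, if_neg hip, if_neg hiq]

lemma rotate_apply_right {p q : Fin n} (hpq : p ≠ q) (u : ℝ × ℂ) (A : Matrix (Fin n) (Fin n) ℂ)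
    {i : Fin n} (hip : i ≠ p) (hiq : i ≠ q) :
    rotate p q u A i q = -(A i p * u.2) + A i q * u.1 := by
  rw [rotate, mul_pivotUnitary_apply hpq, if_neg hpq.symm, if_pos rfl]
  simp only [conjTranspose_pivotUnitary_mul_apply hpq, if_neg hip, if_neg hiq]

lemma rotate_apply_left {p q : Fin n} (hpq : p ≠ q) (u : ℝ × ℂ) (A : Matrix (Fin n) (Fin n) ℂ)
    {i : Fin n} (hip : i ≠ p) (hiq : i ≠ q) :
    rotate p q u A q i = -(star u.2 * A p i) + u.1 * A q i := by
  rw [rotate, mul_pivotUnitary_apply hpq, if_neg hip, if_neg hiq,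
    conjTranspose_pivotUnitary_mul_apply hpq, if_neg hpq.symm, if_pos rfl]

/-- A rotation whose plane lies in the span of the indices in `S` keeps a zero `S × S` block. -/
lemma rotate_eq_zero_on {p q : Fin n} (hpq : p ≠ q) (u : ℝ × ℂ) {A : Matrix (Fin n) (Fin n) ℂ}
    {S : Set (Fin n)} (hp : p ∈ S) (hq : q ∈ S) (hA : ∀ i ∈ S, ∀ j ∈ S, A i j = 0) :
    ∀ i ∈ S, ∀ j ∈ S, rotate p q u A i j = 0 := by
  intro i hi j hj
  rw [rotate, mul_pivotUnitary_apply hpq]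
  simp only [conjTranspose_pivotUnitary_mul_apply hpq]
  split_ifs <;> simp [hA, hp, hq, hi, hj]

lemma rotate_neg_rotate {p q : Fin n} (hpq : p ≠ q) {u : ℝ × ℂ} (hu : u ∈ angleParams)
    (A : Matrix (Fin n) (Fin n) ℂ) : rotate p q (u.1, -u.2) (rotate p q u A) = A := by
  have h := pivotUnitary_mul_conjTranspose hpq hu
  rw [rotate, rotate, ← pivotUnitary_conjTranspose hpq, conjTranspose_conjTranspose,
    Matrix.mul_assoc, Matrix.mul_assoc, h, Matrix.mul_one, ← Matrix.mul_assoc, h, Matrix.one_mul]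

lemma pivotUnitary_apply_of_ne {p q i j : Fin n} (u : ℝ × ℂ) (hp : j ≠ p) (hq : j ≠ q) :
    pivotUnitary p q u i j = if i = j then 1 else 0 := by
  simp [pivotUnitary, hp, hq]

lemma pivotUnitary_comm {p q r s : Fin n} (hpq : p ≠ q) (hrs : r ≠ s)
    (hd : Disjoint ({p, q} : Set (Fin n)) {r, s}) (u v : ℝ × ℂ) :
    pivotUnitary p q u * pivotUnitary r s v = pivotUnitary r s v * pivotUnitary p q u := by
  have h : p ≠ r ∧ p ≠ s ∧ q ≠ r ∧ q ≠ s := by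
    simp only [Set.disjoint_left, Set.mem_insert_iff, Set.mem_singleton_iff] at hd
    exact ⟨fun e => hd (.inl rfl) (.inl e), fun e => hd (.inl rfl) (.inr e),
      fun e => hd (.inr rfl) (.inl e), fun e => hd (.inr rfl) (.inr e)⟩
  -- Off the columns `r`, `s` the second factor is the identity. The remaining columns lie off `p`
  -- and `q`, so they are covered by the same computation with the two factors exchanged.
  have key : ∀ {p q r s : Fin n}, p ≠ q → r ≠ s → p ≠ r → p ≠ s → q ≠ r → q ≠ s →
      ∀ (u v : ℝ × ℂ) (i j : Fin n), j ≠ r → j ≠ s →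
      (pivotUnitary p q u * pivotUnitary r s v) i j =
        (pivotUnitary r s v * pivotUnitary p q u) i j := by
    intro p q r s hpq hrs h1 h2 h3 h4 u v i j hr hs
    rw [mul_pivotUnitary_apply hrs, if_neg hr, if_neg hs, mul_pivotUnitary_apply hpq,
      pivotUnitary_apply_of_ne v h1 h2, pivotUnitary_apply_of_ne v h3 h4,
      pivotUnitary_apply_of_ne v hr hs]
    simp only [pivotUnitary, of_apply]
    grind
  obtain ⟨h1, h2, h3, h4⟩ := h
  ext i j
  by_cases hj : j = r ∨ j = s
  · refine (key hrs hpq h1.symm h3.symm h2.symm h4.symm v u i j ?_ ?_).symm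
    · rintro rfl
      exact hj.elim h1 h2
    · rintro rfl
      exact hj.elim h3 h4
  · rw [not_or] at hj
    exact key hpq hrs h1 h2 h3 h4 u v i j hj.1 hj.2

lemma rotate_comm {p q r s : Fin n} (hpq : p ≠ q) (hrs : r ≠ s)
    (hd : Disjoint ({p, q} : Set (Fin n)) {r, s}) (u v : ℝ × ℂ) (A : Matrix (Fin n) (Fin n) ℂ) :
    rotate p q u (rotate r s v A) = rotate r s v (rotate p q u A) := by
  have h := pivotUnitary_comm hpq hrs hd u v
  have h' : (pivotUnitary p q u)ᴴ * (pivotUnitary r s v)ᴴ =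
      (pivotUnitary r s v)ᴴ * (pivotUnitary p q u)ᴴ := by
    rw [← conjTranspose_mul, ← conjTranspose_mul, h]
  simp only [rotate]
  calc _ = ((pivotUnitary p q u)ᴴ * (pivotUnitary r s v)ᴴ) * A *
        (pivotUnitary r s v * pivotUnitary p q u) := by simp only [Matrix.mul_assoc]
    _ = _ := by rw [h', ← h]; simp only [Matrix.mul_assoc]

lemma rotate_submatrix (σ : Equiv.Perm (Fin n)) (p q : Fin n) (u : ℝ × ℂ)
    (A : Matrix (Fin n) (Fin n) ℂ) :
    rotate (σ p) (σ q) u (A.submatrix σ.symm σ.symm) =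
      (rotate p q u A).submatrix σ.symm σ.symm := by
  have h : pivotUnitary (σ p) (σ q) u = (pivotUnitary p q u).submatrix σ.symm σ.symm := by
    ext i j
    simp [pivotUnitary, Equiv.symm_apply_eq]
  rw [rotate, rotate, h, conjTranspose_submatrix, submatrix_mul_equiv, submatrix_mul_equiv]

/-! ### Lossless runs -/

/-- `B` arises from the matrix `A` with zero diagonal by an admissible rotation in the plane of the
pivot pair `x`, and both pivot entries of `A` vanish, so that nothing is lost when the pivot is
annihilated. Neither the order of the two elements of `x` nor Hermitian symmetry of `A` matters. -/
structure LosslessStep (x : Fin n × Fin n) (A B : Matrix (Fin n) (Fin n) ℂ) : Prop where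
  ne : x.1 ≠ x.2
  diag : ∀ i, A i i = 0
  pivot : A x.1 x.2 = 0
  pivot' : A x.2 x.1 = 0
  rot : ∃ u ∈ angleParams, B = rotate x.1 x.2 u A

namespace LosslessStep

variable {x y : Fin n × Fin n} {A B C : Matrix (Fin n) (Fin n) ℂ}

/-- The pivot submatrix stays zero, because it is zero before the rotation. -/
lemma pivot_block (h : LosslessStep x A B) :
    ∀ i ∈ ({x.1, x.2} : Set (Fin n)), ∀ j ∈ ({x.1, x.2} : Set (Fin n)), B i j = 0 := by
  obtain ⟨u, -, rfl⟩ := h.rot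
  refine rotate_eq_zero_on h.ne u (by simp) (by simp) ?_
  rintro i (rfl | rfl) j (rfl | rfl)
  exacts [h.diag _, h.pivot, h.pivot', h.diag _]

lemma diag_right (h : LosslessStep x A B) (i : Fin n) : B i i = 0 := by
  by_cases hi : i ∈ ({x.1, x.2} : Set (Fin n))
  · exact h.pivot_block i hi i hi
  · obtain ⟨u, -, rfl⟩ := h.rot
    simp only [Set.mem_insert_iff, Set.mem_singleton_iff, not_or] at hi
    rw [rotate_apply h.ne u A hi.1 hi.2 hi.1 hi.2, h.diag]

/-- A lossless step can be undone by a lossless step, the one with the inverse rotation. -/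
lemma reverse (h : LosslessStep x A B) : LosslessStep x B A := by
  refine ⟨h.ne, h.diag_right, h.pivot_block _ (by simp) _ (by simp),
    h.pivot_block _ (by simp) _ (by simp), ?_⟩
  obtain ⟨u, hu, rfl⟩ := h.rot
  exact ⟨_, neg_mem_angleParams hu, (rotate_neg_rotate h.ne hu A).symm⟩

lemma swap (h : LosslessStep x A B) : LosslessStep (x.2, x.1) A B := by
  refine ⟨h.ne.symm, h.diag, h.pivot', h.pivot, ?_⟩
  obtain ⟨u, hu, rfl⟩ := h.rot
  refine ⟨_, neg_star_mem_angleParams hu, ?_⟩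
  simp only [rotate, pivotUnitary_swap h.ne]

lemma permute (σ : Equiv.Perm (Fin n)) (h : LosslessStep x A B) :
    LosslessStep (min (σ x.1) (σ x.2), max (σ x.1) (σ x.2))
      (A.submatrix σ.symm σ.symm) (B.submatrix σ.symm σ.symm) := by
  have key : LosslessStep (σ x.1, σ x.2)
      (A.submatrix σ.symm σ.symm) (B.submatrix σ.symm σ.symm) := by
    refine ⟨fun e => h.ne (σ.injective e), fun i => h.diag _, ?_, ?_, ?_⟩
    · simpa using h.pivot
    · simpa using h.pivot'
    · obtain ⟨u, hu, rfl⟩ := h.rot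
      exact ⟨u, hu, (rotate_submatrix σ _ _ u A).symm⟩
  rcases le_total (σ x.1) (σ x.2) with hle | hle
  · simpa [hle] using key
  · simpa [hle] using key.swap

/-- Lossless steps with disjoint pivot pairs can be exchanged. -/
lemma comm (hd : Disjoint ({x.1, x.2} : Set (Fin n)) {y.1, y.2})
    (h : LosslessStep x A B) (h' : LosslessStep y B C) :
    ∃ B', LosslessStep y A B' ∧ LosslessStep x B' C := by
  obtain ⟨u, hu, rfl⟩ := h.rot
  obtain ⟨v, hv, rfl⟩ := h'.rot
  have hd' := hd
  simp only [Set.disjoint_left, Set.mem_insert_iff, Set.mem_singleton_iff] at hd'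
  have h1 : x.1 ≠ y.1 := fun e => hd' (.inl rfl) (.inl e)
  have h2 : x.1 ≠ y.2 := fun e => hd' (.inl rfl) (.inr e)
  have h3 : x.2 ≠ y.1 := fun e => hd' (.inr rfl) (.inl e)
  have h4 : x.2 ≠ y.2 := fun e => hd' (.inr rfl) (.inr e)
  have hy : LosslessStep y A (rotate y.1 y.2 v A) := by
    refine ⟨h'.ne, h.diag, ?_, ?_, v, hv, rfl⟩
    · rw [← h'.pivot, rotate_apply h.ne u A h1.symm h3.symm h2.symm h4.symm]
    · rw [← h'.pivot', rotate_apply h.ne u A h2.symm h4.symm h1.symm h3.symm]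
  refine ⟨_, hy, h.ne, hy.diag_right, ?_, ?_, u, hu, (rotate_comm h.ne h'.ne hd u v A).symm⟩
  · rw [rotate_apply h'.ne v A h1 h2 h3 h4, h.pivot]
  · rw [rotate_apply h'.ne v A h3 h4 h1 h2, h.pivot']

end LosslessStep

/-- `LosslessRun L A B`: a sequence of lossless steps with the pivot pairs listed in `L` leads from
`A` to `B`. -/
def LosslessRun : List (Fin n × Fin n) → Matrix (Fin n) (Fin n) ℂ → Matrix (Fin n) (Fin n) ℂ → Prop
  | [], A, B => A = B
  | x :: L, A, B => ∃ C, LosslessStep x A C ∧ LosslessRun L C B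

/-- `L` is forcing if no nonzero matrix with zero diagonal admits a lossless run through `L`. -/
def Forcing (L : List (Fin n × Fin n)) : Prop :=
  ∀ A B : Matrix (Fin n) (Fin n) ℂ, (∀ i, A i i = 0) → LosslessRun L A B → A = 0

namespace LosslessRun

variable {L L' : List (Fin n × Fin n)} {A B : Matrix (Fin n) (Fin n) ℂ}

lemma append_iff : LosslessRun (L ++ L') A B ↔ ∃ C, LosslessRun L A C ∧ LosslessRun L' C B := by
  induction L generalizing A with
  | nil => simp [LosslessRun]
  | cons x L ih =>
    simp only [List.cons_append, LosslessRun, ih]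
    exact ⟨fun ⟨C, h, D, h', h''⟩ => ⟨D, ⟨C, h, h'⟩, h''⟩,
      fun ⟨D, ⟨C, h, h'⟩, h''⟩ => ⟨C, h, D, h', h''⟩⟩

lemma singleton_iff {x : Fin n × Fin n} : LosslessRun [x] A B ↔ LosslessStep x A B := by
  simp [LosslessRun]

lemma reverse (h : LosslessRun L A B) : LosslessRun L.reverse B A := by
  induction L generalizing A with
  | nil => exact h.symm
  | cons x L ih =>
    obtain ⟨C, h1, h2⟩ := h
    rw [List.reverse_cons, append_iff]
    exact ⟨C, ih h2, singleton_iff.2 h1.reverse⟩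

lemma diag_right (h : LosslessRun L A B) (hA : ∀ i, A i i = 0) : ∀ i, B i i = 0 := by
  induction L generalizing A with
  | nil => exact h ▸ hA
  | cons x L ih =>
    obtain ⟨C, h1, h2⟩ := h
    exact ih h2 h1.diag_right

lemma eq_zero_on {S : Set (Fin n)} (hL : ∀ x ∈ L, x.1 ∈ S ∧ x.2 ∈ S) (h : LosslessRun L A B)
    (hA : ∀ i ∈ S, ∀ j ∈ S, A i j = 0) : ∀ i ∈ S, ∀ j ∈ S, B i j = 0 := by
  induction L generalizing A with
  | nil => exact h ▸ hA
  | cons x L ih =>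
    obtain ⟨C, h1, h2⟩ := h
    obtain ⟨u, -, rfl⟩ := h1.rot
    have hx := hL x (by simp)
    exact ih (fun y hy => hL y (by simp [hy])) h2 (rotate_eq_zero_on h1.ne u hx.1 hx.2 hA)

lemma eq_zero (h : LosslessRun L A B) (hA : A = 0) : B = 0 := by
  ext i j
  exact h.eq_zero_on (S := Set.univ) (by simp) (by simp [hA]) i trivial j trivial

lemma permute (σ : Equiv.Perm (Fin n)) (h : LosslessRun L A B) :
    LosslessRun (L.map fun x => (min (σ x.1) (σ x.2), max (σ x.1) (σ x.2)))
      (A.submatrix σ.symm σ.symm) (B.submatrix σ.symm σ.symm) := by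
  induction L generalizing A with
  | nil => exact congrArg (fun M => M.submatrix σ.symm σ.symm) h
  | cons x L ih =>
    obtain ⟨C, h1, h2⟩ := h
    exact ⟨_, h1.permute σ, ih h2⟩

lemma of_admissibleTransposition (hL : AdmissibleTransposition L L') (h : LosslessRun L A B) :
    LosslessRun L' A B := by
  obtain ⟨L₁, L₂, a, b, hd, rfl, rfl⟩ := hL
  obtain ⟨C, h1, D, h2, E, h3, h4⟩ := append_iff.1 h
  obtain ⟨D', h5, h6⟩ := h2.comm hd h3
  exact append_iff.2 ⟨C, h1, D', h5, E, h6, h4⟩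

lemma of_equivalent (hL : Equivalent L L') (h : LosslessRun L A B) : LosslessRun L' A B := by
  induction hL with
  | refl => exact h
  | tail _ h' ih => exact ih.of_admissibleTransposition h'

/-- If lossless runs through `L` are lossless runs through `L'`, the same holds for repetitions of
the two lists. -/
lemma replicate_flatten_mono (hL : ∀ A B, LosslessRun L A B → LosslessRun L' A B) (m : ℕ)
    (h : LosslessRun (List.replicate m L).flatten A B) :
    LosslessRun (List.replicate m L').flatten A B := by
  induction m generalizing A with
  | zero => exact h
  | succ m ih =>
    rw [List.replicate_succ, List.flatten_cons, append_iff] at h ⊢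
    obtain ⟨C, h1, h2⟩ := h
    exact ⟨C, hL _ _ h1, ih h2⟩

end LosslessRun

/-! ### Forcing lists and the equivalences of pivot orderings -/

namespace Forcing

variable {L L' : List (Fin n × Fin n)}

/-- Running backwards turns a lossless run through `L.reverse` into one through `L`. -/
lemma reverse (h : Forcing L) : Forcing L.reverse := by
  intro A B hA hr
  have hr' := hr.reverse
  rw [List.reverse_reverse] at hr'
  exact hr'.eq_zero (h B A (hr.diag_right hA) hr')

/-- Steps before and after `L` do no harm, since a lossless run ends in zero if and only if it
starts in zero. -/
lemma append_append (h : Forcing L) (L₁ L₂ : List (Fin n × Fin n)) : Forcing (L₁ ++ L ++ L₂) := by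
  intro A B hA hr
  obtain ⟨D, h1, -⟩ := LosslessRun.append_iff.1 hr
  obtain ⟨C, h2, h3⟩ := LosslessRun.append_iff.1 h1
  exact h2.reverse.eq_zero (h C D (h2.diag_right hA) h3)

lemma of_permute (σ : Equiv.Perm (Fin n))
    (h : Forcing (L.map fun x => (min (σ x.1) (σ x.2), max (σ x.1) (σ x.2)))) : Forcing L := by
  intro A B hA hr
  have h0 : A.submatrix σ.symm σ.symm = 0 := h _ _ (fun i => hA (σ.symm i)) (hr.permute σ)
  ext i j
  simpa using congrFun (congrFun h0 (σ i)) (σ j)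

end Forcing

lemma flatten_replicate_append_comm (L L' : List (Fin n × Fin n)) (m : ℕ) :
    (List.replicate (m + 1) (L' ++ L)).flatten =
      L' ++ (List.replicate m (L ++ L')).flatten ++ L := by
  induction m with
  | zero => simp
  | succ m ih =>
    rw [List.replicate_succ, List.flatten_cons, ih, List.replicate_succ, List.flatten_cons]
    simp only [List.append_assoc]

/-- Some number of repetitions of `L` is forcing. Unlike `Forcing`, this property is invariant under
cyclic shifts. -/
def EventuallyForcing (L : List (Fin n × Fin n)) : Prop :=
  ∃ m : ℕ, Forcing (List.replicate m L).flatten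

namespace EventuallyForcing

variable {L L' : List (Fin n × Fin n)}

lemma of_forcing (h : Forcing L) : EventuallyForcing L := ⟨1, by simpa using h⟩

lemma of_equivalent (hL : Equivalent L L') (h : EventuallyForcing L') : EventuallyForcing L := by
  obtain ⟨m, h⟩ := h
  exact ⟨m, fun A B hA hr => h A B hA
    (hr.replicate_flatten_mono (fun _ _ hr' => hr'.of_equivalent hL))⟩

/-- One further cycle makes up for a shift: `m + 1` cycles through `L₁ ++ L₂` contain `m` cycles
through `L₂ ++ L₁`. -/
lemma of_shiftEquivalent (hL : ShiftEquivalent L L') (h : EventuallyForcing L') :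
    EventuallyForcing L := by
  obtain ⟨L₁, L₂, rfl, rfl⟩ := hL
  obtain ⟨m, h⟩ := h
  refine ⟨m + 1, ?_⟩
  rw [flatten_replicate_append_comm]
  exact h.append_append _ _

lemma of_weakEquivalent (hL : WeakEquivalent L L') (h : EventuallyForcing L') :
    EventuallyForcing L := by
  induction hL using Relation.ReflTransGen.head_induction_on with
  | refl => exact h
  | head h' _ ih =>
    obtain ⟨-, -, h' | h'⟩ := h'
    exacts [ih.of_equivalent h', ih.of_shiftEquivalent h']

lemma of_permutationEquivalent (hL : PermutationEquivalent L L') (h : EventuallyForcing L') :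
    EventuallyForcing L := by
  obtain ⟨σ, rfl⟩ := hL
  obtain ⟨m, h⟩ := h
  refine ⟨m, Forcing.of_permute σ ?_⟩
  rwa [List.map_flatten, List.map_replicate]

end EventuallyForcing

/-! ### Serial orderings are forcing -/

/-- If the block with indices in `l` is zero, a lossless run through column `j` forces the entries
`(i, j)` and `(j, i)`, `i ∈ l`, to vanish. The first pivot entry vanishes by assumption; as the block
is zero, its rotation merely multiplies the other entries of column `j` by `c ≠ 0`. -/
lemma LosslessRun.eq_zero_of_column {j : Fin n} {l : List (Fin n)} (hl : l.Nodup) (hj : j ∉ l)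
    {A B : Matrix (Fin n) (Fin n) ℂ} (hA : ∀ i ∈ l, ∀ k ∈ l, A i k = 0)
    (h : LosslessRun (l.map fun i => (i, j)) A B) : ∀ i ∈ l, A i j = 0 ∧ A j i = 0 := by
  induction l generalizing A with
  | nil => simp
  | cons p l ih =>
    obtain ⟨C, h1, h2⟩ := h
    obtain ⟨u, hu, rfl⟩ := h1.rot
    have hc := angleParams_ne_zero hu
    simp only [List.mem_cons, not_or] at hj
    obtain ⟨hpl, hl⟩ := List.nodup_cons.1 hl
    have hp : p ≠ j := h1.ne
    have hne : ∀ i ∈ l, i ≠ p ∧ i ≠ j :=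
      fun i hi => ⟨fun e => hpl (e ▸ hi), fun e => hj.2 (e ▸ hi)⟩
    -- The rows and columns in `l` other than `p` and `j` are not touched by the first rotation.
    have ih' := ih hl hj.2 (fun i hi k hk => by
      rw [rotate_apply hp u A (hne i hi).1 (hne i hi).2 (hne k hk).1 (hne k hk).2]
      exact hA i (by simp [hi]) k (by simp [hk])) h2
    intro i hi
    rcases List.mem_cons.1 hi with rfl | hi
    · exact ⟨h1.pivot, h1.pivot'⟩
    · have h3 := ih' i hi
      rw [rotate_apply_right hp u A (hne i hi).1 (hne i hi).2,
        rotate_apply_left hp u A (hne i hi).1 (hne i hi).2,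
        hA i (by simp [hi]) p (by simp), hA p (by simp) i (by simp [hi])] at h3
      simpa [hc] using h3

/-- Passing the columns from left to right, each in an arbitrary order, is forcing: after column `j`
the leading block up to and including `j` is zero. -/
lemma forcing_of_columns (l : Fin n → List (Fin n)) (hl : ∀ j, (l j).Nodup)
    (hmem : ∀ i j, i ∈ l j ↔ i < j) :
    Forcing ((List.finRange n).flatMap fun j => (l j).map fun i => (i, j)) := by
  intro A B hA hr
  suffices h : ∀ k ≤ n, ∀ B, LosslessRun
      (((List.finRange n).take k).flatMap fun j => (l j).map fun i => (i, j)) A B →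
      ∀ i ∈ {i : Fin n | (i : ℕ) < k}, ∀ j ∈ {i : Fin n | (i : ℕ) < k}, B i j = 0 by
    -- The final matrix is zero, hence so is the initial one.
    refine hr.reverse.eq_zero ?_
    ext i j
    refine h n le_rfl B ?_ i i.2 j j.2
    rwa [List.take_of_length_le (by simp)]
  intro k
  induction k with
  | zero => simp
  | succ k ih =>
    intro hk B hB
    have htake : (List.finRange n).take (k + 1) = (List.finRange n).take k ++ [⟨k, hk⟩] := by
      rw [List.take_add_one]
      have hk' : k < (List.finRange n).length := by simpa using hk
      simp [List.getElem?_eq_getElem hk']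
    rw [htake, List.flatMap_append, List.flatMap_singleton, LosslessRun.append_iff] at hB
    obtain ⟨C, h1, h2⟩ := hB
    have hC := ih (by omega) C h1
    have hcol := h2.eq_zero_of_column (hl _) (by simp [hmem]) (fun i hi j hj =>
      hC i (by simpa [hmem, Fin.lt_def] using hi) j (by simpa [hmem, Fin.lt_def] using hj))
    have hdiag := h1.diag_right hA
    refine h2.eq_zero_on ?_ ?_
    · simp only [List.mem_map, hmem, Set.mem_ofPred_eq]
      rintro _ ⟨i, hi, rfl⟩
      have : (i : ℕ) < k := hi
      exact ⟨by simp; omega, by simp⟩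
    · intro i hi j hj
      simp only [Set.mem_ofPred_eq] at hi hj
      rcases Nat.lt_succ_iff_lt_or_eq.1 hi with hi' | hi' <;>
        rcases Nat.lt_succ_iff_lt_or_eq.1 hj with hj' | hj'
      · exact hC i hi' j hj'
      · obtain rfl : j = ⟨k, hk⟩ := Fin.ext hj'
        exact (hcol i ((hmem _ _).2 hi')).1
      · obtain rfl : i = ⟨k, hk⟩ := Fin.ext hi'
        exact (hcol j ((hmem _ _).2 hj')).2
      · obtain rfl : i = j := Fin.ext (hi'.trans hj'.symm)
        exact hdiag i

lemma apply_mem_iff_of_mem_permsOf {s : Set (Fin n)} {τ : Equiv.Perm (Fin n)} (hτ : τ ∈ permsOf s)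
    (i : Fin n) : τ i ∈ s ↔ i ∈ s := by
  constructor
  · intro h
    by_contra hi
    exact hi (hτ i hi ▸ h)
  · intro h
    by_contra hi
    have := τ.injective (hτ _ hi)
    exact hi (this.symm ▸ h)

lemma forcing_of_mem_columnwise {L : List (Fin n × Fin n)} (hL : L ∈ columnwise n) :
    Forcing L := by
  obtain ⟨-, τ, hτ, rfl⟩ := hL
  have h := forcing_of_columns (fun j => ((List.finRange n).filter (· < j)).map (τ j))
    (fun j => ((List.nodup_finRange n).filter _).map (τ j).injective) (fun i j => by
      have h := apply_mem_iff_of_mem_permsOf (hτ j) ((τ j).symm i)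
      simp only [Equiv.apply_symm_apply, Set.mem_Iio] at h
      rw [h]
      simp only [List.mem_map, List.mem_filter, List.mem_finRange, true_and, decide_eq_true_eq]
      exact ⟨fun ⟨a, ha, e⟩ => by rwa [← e, Equiv.symm_apply_apply],
        fun h' => ⟨_, h', by simp⟩⟩)
  simpa [columnOrdering, Function.comp_def] using h

/-- Reversing the order of the indices turns a row-wise ordering from bottom to top into a
column-wise ordering from left to right. -/
lemma forcing_of_mem_rowwise {L : List (Fin n × Fin n)} (hL : L ∈ rowwise n) : Forcing L := by
  obtain ⟨-, τ, hτ, rfl⟩ := hL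
  have hlt : ∀ i j : Fin n, i < j → i < τ i j :=
    fun i j h => (apply_mem_iff_of_mem_permsOf (hτ i) j).2 h
  have h := forcing_of_columns
    (fun j => ((List.finRange n).filter (Fin.rev j < ·)).map fun i => Fin.rev (τ (Fin.rev j) i))
    (fun j => ((List.nodup_finRange n).filter _).map
      (Fin.rev_injective.comp (τ _).injective)) (fun i j => by
      have h := apply_mem_iff_of_mem_permsOf (hτ (Fin.rev j)) ((τ (Fin.rev j)).symm (Fin.rev i))
      simp only [Equiv.apply_symm_apply, Set.mem_Ioi, Fin.rev_lt_rev] at h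
      rw [h]
      simp only [List.mem_map, List.mem_filter, List.mem_finRange, true_and, decide_eq_true_eq]
      exact ⟨fun ⟨a, ha, e⟩ => by rwa [← e, Fin.rev_rev, Equiv.symm_apply_apply],
        fun h' => ⟨_, h', by simp⟩⟩)
  refine Forcing.of_permute Fin.revPerm ?_
  convert h using 1
  rw [rowOrdering, List.finRange_reverse, List.flatMap_map, List.map_flatMap]
  refine List.flatMap_congr fun j _ => ?_
  rw [List.map_map, List.map_map]
  refine List.map_congr_left fun i hi => ?_
  have hi' : Fin.rev (τ (Fin.rev j) i) < j := by
    have := hlt (Fin.rev j) i (by simpa using hi)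
    rwa [← Fin.rev_lt_rev, Fin.rev_rev]
  simp [hi'.le]

lemma eventuallyForcing_of_mem_generalizedSerial {L : List (Fin n × Fin n)}
    (hL : L ∈ generalizedSerial n) : EventuallyForcing L := by
  obtain ⟨-, L', -, L'', hs, h⟩ := hL
  have hf : EventuallyForcing L'' := by
    refine .of_forcing ?_
    rcases hs with hs | hs | hs | hs
    · exact forcing_of_mem_columnwise hs
    · simpa using (forcing_of_mem_columnwise hs).reverse
    · exact forcing_of_mem_rowwise hs
    · simpa using (forcing_of_mem_rowwise hs).reverse
  rcases h with ⟨h1, h2⟩ | ⟨h1, h2⟩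
  · exact (hf.of_permutationEquivalent h2).of_weakEquivalent h1
  · exact (hf.of_weakEquivalent h2).of_permutationEquivalent h1

/-! ### The Jacobi step as a nonexpansive linear map -/

attribute [local instance] Matrix.frobeniusNormedAddCommGroup
attribute [local instance] Matrix.frobeniusNormedSpace

lemma norm_sq_eq_sum (A : Matrix (Fin n) (Fin n) ℂ) : ‖A‖ ^ 2 = ∑ i, ∑ j, ‖A i j‖ ^ 2 := by
  rw [frobenius_norm_def, ← Real.sqrt_eq_rpow, Real.sq_sqrt (by positivity)]
  simp

/-- The Frobenius norm through the trace, from which its unitary invariance is read off. -/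
lemma norm_sq_eq_trace (A : Matrix (Fin n) (Fin n) ℂ) : ((‖A‖ ^ 2 : ℝ) : ℂ) = (Aᴴ * A).trace := by
  rw [norm_sq_eq_sum, Finset.sum_comm]
  simp only [trace, diag_apply, mul_apply, conjTranspose_apply, Complex.ofReal_sum]
  refine Finset.sum_congr rfl fun i _ => Finset.sum_congr rfl fun j _ => ?_
  rw [Complex.star_def, mul_comm, Complex.mul_conj, Complex.normSq_eq_norm_sq]

lemma norm_rotate {p q : Fin n} (hpq : p ≠ q) {u : ℝ × ℂ} (hu : u ∈ angleParams)
    (A : Matrix (Fin n) (Fin n) ℂ) : ‖rotate p q u A‖ = ‖A‖ := by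
  have h := pivotUnitary_mul_conjTranspose hpq hu
  suffices h2 : ‖rotate p q u A‖ ^ 2 = ‖A‖ ^ 2 from
    (sq_eq_sq₀ (norm_nonneg _) (norm_nonneg _)).1 h2
  rw [← Complex.ofReal_inj, norm_sq_eq_trace, norm_sq_eq_trace, conjTranspose_rotate, rotate, rotate]
  set U := pivotUnitary p q u
  calc (Uᴴ * Aᴴ * U * (Uᴴ * A * U)).trace
      = (Uᴴ * (Aᴴ * (U * Uᴴ) * A * U)).trace := by simp only [Matrix.mul_assoc]
    _ = (Aᴴ * (U * Uᴴ) * A * (U * Uᴴ)).trace := by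
      rw [trace_mul_comm]; simp only [Matrix.mul_assoc]
    _ = (Aᴴ * A).trace := by rw [h, Matrix.mul_one, Matrix.mul_one]

lemma norm_le_of_forall_eq_or_eq_zero {A B : Matrix (Fin n) (Fin n) ℂ}
    (h : ∀ i j, B i j = A i j ∨ B i j = 0) : ‖B‖ ≤ ‖A‖ := by
  rw [← sq_le_sq₀ (norm_nonneg _) (norm_nonneg _), norm_sq_eq_sum, norm_sq_eq_sum]
  refine Finset.sum_le_sum fun i _ => Finset.sum_le_sum fun j _ => ?_
  rcases h i j with h | h <;> rw [h]
  simp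

/-- Setting entries to zero without losing norm changes nothing. -/
lemma eq_of_norm_le {A B : Matrix (Fin n) (Fin n) ℂ}
    (h : ∀ i j, B i j = A i j ∨ B i j = 0) (hAB : ‖A‖ ≤ ‖B‖) : B = A := by
  have hle : ∀ i j, ‖B i j‖ ^ 2 ≤ ‖A i j‖ ^ 2 := fun i j => by
    rcases h i j with h | h <;> rw [h]
    simp
  have heq := congrArg (· ^ 2) (le_antisymm (norm_le_of_forall_eq_or_eq_zero h) hAB)
  simp only [norm_sq_eq_sum] at heq
  have h1 := (Finset.sum_eq_sum_iff_of_le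
    (fun i _ => Finset.sum_le_sum fun j _ => hle i j)).1 heq
  ext i j
  have h2 := (Finset.sum_eq_sum_iff_of_le (fun j _ => hle i j)).1 (h1 i (Finset.mem_univ i))
    j (Finset.mem_univ j)
  rcases h i j with h | h
  · exact h
  · rw [h] at h2 ⊢
    simpa [eq_comm] using h2

/-- `A` with its diagonal and its two pivot entries replaced by zero. -/
def pivotFree (x : Fin n × Fin n) (A : Matrix (Fin n) (Fin n) ℂ) : Matrix (Fin n) (Fin n) ℂ :=
  Matrix.of fun i j =>
    if i = j ∨ (i = x.1 ∧ j = x.2) ∨ (i = x.2 ∧ j = x.1) then 0 else A i j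

/-- The Jacobi step on off-diagonal parts: annihilate the pivot entries, then rotate. The rotation
keeps the zero diagonal and the zero pivot entries, so this agrees with rotating first and deleting
the diagonal and the pivot entries afterwards (`pivotFree_rotate_eq_zero`). -/
def jacobiStep (x : Fin n × Fin n) (u : ℝ × ℂ) (A : Matrix (Fin n) (Fin n) ℂ) :
    Matrix (Fin n) (Fin n) ℂ :=
  rotate x.1 x.2 u (pivotFree x A)

lemma pivotFree_apply_eq_or (x : Fin n × Fin n) (A : Matrix (Fin n) (Fin n) ℂ) (i j : Fin n) :
    pivotFree x A i j = A i j ∨ pivotFree x A i j = 0 := by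
  simp only [pivotFree, of_apply]
  split_ifs <;> simp

lemma rotate_sub (p q : Fin n) (u : ℝ × ℂ) (A B : Matrix (Fin n) (Fin n) ℂ) :
    rotate p q u (A - B) = rotate p q u A - rotate p q u B := by
  simp [rotate, Matrix.mul_sub, Matrix.sub_mul]

lemma jacobiStep_sub (x : Fin n × Fin n) (u : ℝ × ℂ) (A B : Matrix (Fin n) (Fin n) ℂ) :
    jacobiStep x u (A - B) = jacobiStep x u A - jacobiStep x u B := by
  rw [jacobiStep, jacobiStep, jacobiStep, ← rotate_sub]
  congr 1
  ext i j
  simp only [pivotFree, of_apply, Matrix.sub_apply]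
  split_ifs <;> simp

lemma jacobiStep_smul (x : Fin n × Fin n) (u : ℝ × ℂ) (c : ℝ) (A : Matrix (Fin n) (Fin n) ℂ) :
    jacobiStep x u (c • A) = c • jacobiStep x u A := by
  have h : pivotFree x (c • A) = c • pivotFree x A := by
    ext i j
    simp only [pivotFree, of_apply, Matrix.smul_apply]
    split_ifs <;> simp
  rw [jacobiStep, jacobiStep, h, rotate, rotate, Matrix.mul_smul, Matrix.smul_mul]

lemma losslessStep_pivotFree {x : Fin n × Fin n} (hx : x.1 ≠ x.2) {u : ℝ × ℂ}
    (hu : u ∈ angleParams) (A : Matrix (Fin n) (Fin n) ℂ) :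
    LosslessStep x (pivotFree x A) (jacobiStep x u A) :=
  ⟨hx, fun i => by simp [pivotFree], by simp [pivotFree], by simp [pivotFree], u, hu, rfl⟩

lemma norm_jacobiStep_le {x : Fin n × Fin n} (hx : x.1 ≠ x.2) {u : ℝ × ℂ}
    (hu : u ∈ angleParams) (A : Matrix (Fin n) (Fin n) ℂ) : ‖jacobiStep x u A‖ ≤ ‖A‖ := by
  rw [jacobiStep, norm_rotate hx hu]
  exact norm_le_of_forall_eq_or_eq_zero (pivotFree_apply_eq_or x A)

/-- A Jacobi step that does not decrease the norm is lossless. -/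
lemma losslessStep_of_norm_le {x : Fin n × Fin n} (hx : x.1 ≠ x.2) {u : ℝ × ℂ}
    (hu : u ∈ angleParams) {A : Matrix (Fin n) (Fin n) ℂ} (h : ‖A‖ ≤ ‖jacobiStep x u A‖) :
    LosslessStep x A (jacobiStep x u A) := by
  have h' := losslessStep_pivotFree hx hu A
  rw [jacobiStep, norm_rotate hx hu] at h
  rwa [eq_of_norm_le (pivotFree_apply_eq_or x A) h] at h'

lemma continuous_jacobiStep (x : Fin n × Fin n) {X : Type*} [TopologicalSpace X]
    {f : X → Matrix (Fin n) (Fin n) ℂ} {g : X → ℝ × ℂ} (hf : Continuous f) (hg : Continuous g) :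
    Continuous fun z => jacobiStep x (g z) (f z) := by
  have hU : Continuous fun z => pivotUnitary x.1 x.2 (g z) := by
    refine continuous_matrix fun i j => ?_
    simp only [pivotUnitary, of_apply]
    split_ifs <;> fun_prop
  have hP : Continuous fun z => pivotFree x (f z) := by
    refine continuous_matrix fun i j => ?_
    simp only [pivotFree, of_apply]
    split_ifs
    · fun_prop
    · exact hf.matrix_elem i j
  exact (hU.matrix_conjTranspose.matrix_mul hP).matrix_mul hU

/-- The first `k` Jacobi steps with pivot pairs `I` and rotation parameters `u`. -/
def jacobiIter (I : ℕ → Fin n × Fin n) (u : ℕ → ℝ × ℂ) :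
    ℕ → Matrix (Fin n) (Fin n) ℂ → Matrix (Fin n) (Fin n) ℂ
  | 0, A => A
  | k + 1, A => jacobiStep (I k) (u k) (jacobiIter I u k A)

lemma continuous_jacobiIter (I : ℕ → Fin n × Fin n) (N : ℕ) :
    Continuous fun z : Matrix (Fin n) (Fin n) ℂ × (ℕ → ℝ × ℂ) => jacobiIter I z.2 N z.1 := by
  induction N with
  | zero => exact continuous_fst
  | succ N ih => exact continuous_jacobiStep (I N) ih (by fun_prop)

lemma jacobiIter_smul (I : ℕ → Fin n × Fin n) (u : ℕ → ℝ × ℂ) (N : ℕ) (c : ℝ)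
    (A : Matrix (Fin n) (Fin n) ℂ) : jacobiIter I u N (c • A) = c • jacobiIter I u N A := by
  induction N with
  | zero => rfl
  | succ N ih => rw [jacobiIter, ih, jacobiStep_smul, jacobiIter]

lemma norm_jacobiIter_le {I : ℕ → Fin n × Fin n} (hI : ∀ k, (I k).1 ≠ (I k).2)
    {u : ℕ → ℝ × ℂ} (hu : ∀ k, u k ∈ angleParams) (N : ℕ) (A : Matrix (Fin n) (Fin n) ℂ) :
    ‖jacobiIter I u N A‖ ≤ ‖A‖ := by
  induction N with
  | zero => exact le_rfl
  | succ N ih => exact (norm_jacobiStep_le (hI N) (hu N) _).trans ih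

lemma losslessRun_of_norm_le {I : ℕ → Fin n × Fin n} (hI : ∀ k, (I k).1 ≠ (I k).2)
    {u : ℕ → ℝ × ℂ} (hu : ∀ k, u k ∈ angleParams) {N : ℕ} {A : Matrix (Fin n) (Fin n) ℂ}
    (h : ‖A‖ ≤ ‖jacobiIter I u N A‖) :
    LosslessRun ((List.range N).map I) A (jacobiIter I u N A) := by
  induction N with
  | zero => simp [LosslessRun, jacobiIter]
  | succ N ih =>
    rw [List.range_succ, List.map_append, LosslessRun.append_iff]
    refine ⟨_, ih (h.trans (norm_jacobiStep_le (hI N) (hu N) _)), ?_⟩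
    exact LosslessRun.singleton_iff.2 (losslessStep_of_norm_le (hI N) (hu N)
      ((norm_jacobiIter_le hI hu N A).trans h))

/-! ### Uniform contraction -/

lemma isCompact_angleParams : IsCompact angleParams := by
  refine Metric.isCompact_of_isClosed_isBounded ?_ ?_
  · refine (isClosed_le continuous_const continuous_fst).inter
      (isClosed_eq (by fun_prop) continuous_const)
  · refine (Metric.isBounded_closedBall (x := (0 : ℝ × ℂ)) (r := 1)).subset fun u hu => ?_
    rw [mem_closedBall_zero_iff, Prod.norm_def, max_le_iff]
    have h := hu.2
    refine ⟨?_, ?_⟩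
    · rw [Real.norm_eq_abs, ← sq_le_one_iff_abs_le_one]
      nlinarith [sq_nonneg ‖u.2‖]
    · nlinarith [sq_nonneg u.1, norm_nonneg u.2]

/-- Along a forcing list the Jacobi steps contract, with a factor that does not depend on the
rotations: the norm of the result attains its maximum on the compact set of unit matrices with zero
diagonal and parameter sequences, and the value `1` would give a lossless run from a nonzero
matrix. -/
lemma exists_contraction {I : ℕ → Fin n × Fin n} (hI : ∀ k, (I k).1 ≠ (I k).2) {N : ℕ}
    (hf : Forcing ((List.range N).map I)) :
    ∃ γ : ℝ, 0 ≤ γ ∧ γ < 1 ∧ ∀ u : ℕ → ℝ × ℂ, (∀ k, u k ∈ angleParams) →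
      ∀ A : Matrix (Fin n) (Fin n) ℂ, (∀ i, A i i = 0) → ‖jacobiIter I u N A‖ ≤ γ * ‖A‖ := by
  set S : Set (Matrix (Fin n) (Fin n) ℂ × (ℕ → ℝ × ℂ)) :=
    (Metric.sphere 0 1 ∩ {A | ∀ i, A i i = 0}) ×ˢ Set.pi Set.univ fun _ => angleParams with hS
  have hclosed : IsClosed {A : Matrix (Fin n) (Fin n) ℂ | ∀ i, A i i = 0} := by
    simp only [Set.ofPred_forall]
    exact isClosed_iInter fun i =>
      isClosed_eq (continuous_id.matrix_elem i i) continuous_const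
  have hcomp : IsCompact S :=
    ((isCompact_sphere _ _).inter_right hclosed).prod
      (isCompact_univ_pi fun _ => isCompact_angleParams)
  obtain ⟨γ, hγ0, hγ1, hγ⟩ : ∃ γ : ℝ, 0 ≤ γ ∧ γ < 1 ∧ ∀ z ∈ S, ‖jacobiIter I z.2 N z.1‖ ≤ γ := by
    rcases S.eq_empty_or_nonempty with he | hne
    · exact ⟨0, le_rfl, one_pos, by simp [he]⟩
    obtain ⟨⟨A, u⟩, hz, hmax⟩ :=
      hcomp.exists_isMaxOn hne (continuous_jacobiIter I N).norm.continuousOn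
    refine ⟨_, norm_nonneg _, ?_, hmax⟩
    obtain ⟨⟨h1, h2⟩, h3⟩ := hz
    have hA : ‖A‖ = 1 := by simpa using h1
    by_contra! hge
    have h0 := hf A _ h2 (losslessRun_of_norm_le hI (fun k => h3 k trivial) (hA.trans_le hge))
    simp [h0] at hA
  refine ⟨γ, hγ0, hγ1, fun u hu A hA => ?_⟩
  rcases eq_or_ne A 0 with rfl | hne
  · simpa using norm_jacobiIter_le hI hu N (0 : Matrix (Fin n) (Fin n) ℂ)
  have hpos : 0 < ‖A‖ := norm_pos_iff.2 hne
  have h := hγ (‖A‖⁻¹ • A, u) ⟨⟨by simp [norm_smul, hpos.ne'], fun i => by simp [hA]⟩,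
    fun k _ => hu k⟩
  simp only [jacobiIter_smul, norm_smul, norm_inv, norm_norm] at h
  rwa [inv_mul_le_iff₀ hpos, mul_comm] at h

/-! ### The perturbed process -/

/-- The off-diagonal part of a matrix. -/
def offDiag (A : Matrix (Fin n) (Fin n) ℂ) : Matrix (Fin n) (Fin n) ℂ :=
  Matrix.of fun i j => if i = j then 0 else A i j

lemma off_eq_norm (A : Matrix (Fin n) (Fin n) ℂ) : off A = ‖offDiag A‖ := by
  rw [off, ← Real.sqrt_sq (norm_nonneg (offDiag A)), norm_sq_eq_sum]
  congr 1
  refine Finset.sum_congr rfl fun i _ => Finset.sum_congr rfl fun j _ => ?_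
  simp only [offDiag, of_apply]
  split_ifs <;> simp

lemma norm_apply_le_off {A : Matrix (Fin n) (Fin n) ℂ} {i j : Fin n} (hij : i ≠ j) :
    ‖A i j‖ ≤ off A := by
  refine Real.le_sqrt_of_sq_le ?_
  have h : ∀ i j, 0 ≤ (if i = j then 0 else ‖A i j‖ ^ 2 : ℝ) := fun i j => by positivity
  calc ‖A i j‖ ^ 2 = if i = j then 0 else ‖A i j‖ ^ 2 := (if_neg hij).symm
    _ ≤ ∑ j, if i = j then 0 else ‖A i j‖ ^ 2 :=
      Finset.single_le_sum (f := fun j => if i = j then 0 else ‖A i j‖ ^ 2)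
        (fun j _ => h i j) (Finset.mem_univ j)
    _ ≤ _ := Finset.single_le_sum (f := fun i => ∑ j, if i = j then 0 else ‖A i j‖ ^ 2)
        (fun i _ => Finset.sum_nonneg fun j _ => h i j) (Finset.mem_univ i)

/-- What a rotation makes of the diagonal and of the pivot entries stays in these positions. -/
lemma pivotFree_rotate_eq_zero {x : Fin n × Fin n} (hx : x.1 ≠ x.2) (u : ℝ × ℂ)
    {D : Matrix (Fin n) (Fin n) ℂ} (hD : pivotFree x D = 0) :
    pivotFree x (rotate x.1 x.2 u D) = 0 := by
  have hD' : ∀ i j, i ≠ j → ¬(i = x.1 ∧ j = x.2) → ¬(i = x.2 ∧ j = x.1) → D i j = 0 := by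
    intro i j h1 h2 h3
    have := congrFun (congrFun hD i) j
    simpa [pivotFree, h1, h2, h3] using this
  ext i j
  simp only [pivotFree, of_apply, Matrix.zero_apply]
  split_ifs with h
  · rfl
  simp only [not_or] at h
  rw [rotate, mul_pivotUnitary_apply hx]
  simp only [conjTranspose_pivotUnitary_mul_apply hx]
  grind

/-- The off-diagonal part of `H' = Uᴴ H U + M` differs from a Jacobi step applied to the
off-diagonal part of `H` only by `M` and by the new pivot entries. The diagonal of `M` plays no
role. -/
lemma norm_offDiag_sub_jacobiStep_apply_le {x : Fin n × Fin n} (hx : x.1 ≠ x.2) {u : ℝ × ℂ}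
    (hu : u ∈ angleParams) {H H' M : Matrix (Fin n) (Fin n) ℂ} (hH' : H'.IsHermitian)
    (h : H' = rotate x.1 x.2 u H + M) (i j : Fin n) :
    ‖(offDiag H' - jacobiStep x u (offDiag H)) i j‖ ≤ off M + ‖H' x.1 x.2‖ := by
  have hoff : 0 ≤ off M := Real.sqrt_nonneg _
  have hL := losslessStep_pivotFree hx hu (offDiag H)
  rw [Matrix.sub_apply]
  by_cases hij : i = j
  · subst hij
    rw [hL.diag_right, offDiag, of_apply, if_pos rfl, sub_zero, norm_zero]
    positivity
  rw [offDiag, of_apply, if_neg hij]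
  by_cases hp : i = x.1 ∧ j = x.2
  · rw [hp.1, hp.2, hL.pivot_block _ (by simp) _ (by simp), sub_zero]
    linarith
  by_cases hq : i = x.2 ∧ j = x.1
  · rw [hq.1, hq.2, hL.pivot_block _ (by simp) _ (by simp), sub_zero, ← hH'.apply, norm_star]
    linarith
  have hP : pivotFree x (offDiag H) = pivotFree x H := by
    ext a b
    simp only [pivotFree, offDiag, of_apply]
    grind
  have hD : pivotFree x (H - pivotFree x H) = 0 := by
    ext a b
    simp only [pivotFree, of_apply, Matrix.sub_apply, Matrix.zero_apply]
    grind
  -- Away from the diagonal and the pivot, rotating `H` and rotating `pivotFree x H` agree.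
  have h0 := congrFun (congrFun (pivotFree_rotate_eq_zero hx u hD) i) j
  simp only [pivotFree, of_apply, hij, hp, hq, or_self, if_false, Matrix.zero_apply] at h0
  have h1 : H' i j - jacobiStep x u (offDiag H) i j = M i j := by
    rw [jacobiStep, hP, h, Matrix.add_apply]
    change rotate x.1 x.2 u (H - pivotFree x H) i j = 0 at h0
    rw [rotate_sub, Matrix.sub_apply] at h0
    linear_combination h0
  rw [h1]
  linarith [norm_apply_le_off (A := M) hij, norm_nonneg (H' x.1 x.2)]

/-- A contraction with vanishing perturbations drives every sequence to zero. -/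
lemma tendsto_zero_of_le_mul_add {a δ : ℕ → ℝ} {γ : ℝ} (hγ0 : 0 ≤ γ) (hγ1 : γ < 1)
    (ha : ∀ t, 0 ≤ a t) (hδ : Tendsto δ atTop (𝓝 0)) (h : ∀ t, a (t + 1) ≤ γ * a t + δ t) :
    Tendsto a atTop (𝓝 0) := by
  rw [Metric.tendsto_atTop]
  intro ε hε
  have hpos : 0 < (1 - γ) * (ε / 2) := mul_pos (by linarith) (by linarith)
  obtain ⟨K, hK⟩ := eventually_atTop.1 (hδ.eventually (gt_mem_nhds hpos))
  have key : ∀ j, a (K + j) ≤ γ ^ j * a K + ε / 2 := by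
    intro j
    induction j with
    | zero => simp; linarith
    | succ j ih =>
      have h1 := h (K + j)
      have h2 := hK (K + j) (by omega)
      have h3 := mul_le_mul_of_nonneg_left ih hγ0
      rw [← add_assoc, pow_succ]
      linarith
  have hlim : Tendsto (fun j => γ ^ j * a K) atTop (𝓝 0) := by
    simpa using (tendsto_pow_atTop_nhds_zero_of_lt_one hγ0 hγ1).mul_const (a K)
  obtain ⟨J, hJ⟩ := eventually_atTop.1 (hlim.eventually (gt_mem_nhds (half_pos hε)))
  refine ⟨K + J, fun t ht => ?_⟩
  obtain ⟨j, rfl⟩ := Nat.exists_eq_add_of_le (show K ≤ t by omega)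
  rw [Real.dist_0_eq_abs, abs_of_nonneg (ha _)]
  linarith [key j, hJ j (by omega)]

/-- Since Jacobi steps are nonexpansive, the errors of the single steps at most add up. -/
lemma norm_sub_jacobiIter_le {I : ℕ → Fin n × Fin n} (hI : ∀ k, (I k).1 ≠ (I k).2)
    {u : ℕ → ℝ × ℂ} (hu : ∀ k, u k ∈ angleParams) (A : ℕ → Matrix (Fin n) (Fin n) ℂ) (N : ℕ) :
    ‖A N - jacobiIter I u N (A 0)‖ ≤
      ∑ i ∈ Finset.range N, ‖A (i + 1) - jacobiStep (I i) (u i) (A i)‖ := by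
  induction N with
  | zero => simp [jacobiIter]
  | succ N ih =>
    rw [Finset.sum_range_succ, jacobiIter]
    calc ‖A (N + 1) - jacobiStep (I N) (u N) (jacobiIter I u N (A 0))‖
        = ‖jacobiStep (I N) (u N) (A N - jacobiIter I u N (A 0)) +
            (A (N + 1) - jacobiStep (I N) (u N) (A N))‖ := by
          rw [jacobiStep_sub]; congr 1; abel
      _ ≤ _ := (norm_add_le _ _).trans
          (add_le_add_left ((norm_jacobiStep_le (hI N) (hu N) _).trans ih) _)

lemma tendsto_norm_zero_of_entries {A : ℕ → Matrix (Fin n) (Fin n) ℂ}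
    (h : ∀ i j, Tendsto (fun k => A k i j) atTop (𝓝 0)) :
    Tendsto (fun k => ‖A k‖) atTop (𝓝 0) := by
  refine tendsto_zero_iff_norm_tendsto_zero.1 ?_
  exact tendsto_pi_nhds.2 fun i => tendsto_pi_nhds.2 fun j => h i j

/-- Matrices with zero diagonal that follow the Jacobi steps of a periodic strategy up to vanishing
errors tend to zero, provided that one period is forcing. -/
theorem tendsto_zero_of_periodic {I : ℕ → Fin n × Fin n} (hI : ∀ k, (I k).1 ≠ (I k).2)
    {u : ℕ → ℝ × ℂ} (hu : ∀ k, u k ∈ angleParams) {N : ℕ} (hN : 0 < N)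
    (hper : ∀ k, I (N + k) = I k) (hf : Forcing ((List.range N).map I))
    {A : ℕ → Matrix (Fin n) (Fin n) ℂ} (hA : ∀ k i, A k i i = 0)
    (hE : Tendsto (fun k => ‖A (k + 1) - jacobiStep (I k) (u k) (A k)‖) atTop (𝓝 0)) :
    Tendsto (fun k => ‖A k‖) atTop (𝓝 0) := by
  obtain ⟨γ, hγ0, hγ1, hγ⟩ := exists_contraction hI hf
  have hper' : ∀ t i, I (N * t + i) = I i := by
    intro t i
    induction t with
    | zero => simp
    | succ t ih => rw [← ih, ← hper (N * t + i)]; congr 1; ring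
  set e : ℕ → ℝ := fun k => ‖A (k + 1) - jacobiStep (I k) (u k) (A k)‖ with he
  set δ : ℕ → ℝ := fun t => ∑ i ∈ Finset.range N, e (N * t + i) with hδdef
  have hδ : Tendsto δ atTop (𝓝 0) := by
    have h : ∀ i ∈ Finset.range N, Tendsto (fun t => e (N * t + i)) atTop (𝓝 0) := fun i _ =>
      hE.comp
      (tendsto_atTop_mono (fun t => (Nat.le_mul_of_pos_left t hN).trans (Nat.le_add_right _ i))
        tendsto_id)
    simpa using tendsto_finsetSum _ h
  have hcmp : ∀ t j, j ≤ N →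
      ‖A (N * t + j)‖ ≤ ‖jacobiIter I (fun k => u (N * t + k)) j (A (N * t))‖ + δ t := by
    intro t j hj
    have h := norm_sub_jacobiIter_le hI (u := fun k => u (N * t + k)) (fun k => hu _)
      (fun k => A (N * t + k)) j
    have h2 : ∑ i ∈ Finset.range j, ‖A (N * t + (i + 1)) -
        jacobiStep (I i) (u (N * t + i)) (A (N * t + i))‖ ≤ δ t := by
      calc _ = ∑ i ∈ Finset.range j, e (N * t + i) := by
            simp only [he, hper', add_assoc]
        _ ≤ δ t := Finset.sum_le_sum_of_subset_of_nonneg (Finset.range_mono hj)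
            fun _ _ _ => norm_nonneg _
    have h3 := norm_le_insert' (A (N * t + j))
      (jacobiIter I (fun k => u (N * t + k)) j (A (N * t)))
    simp only [add_zero] at h
    linarith
  -- Convergence along the ends of the periods; within a period the norm grows by at most `δ`.
  have ha : Tendsto (fun t => ‖A (N * t)‖) atTop (𝓝 0) := by
    refine tendsto_zero_of_le_mul_add hγ0 hγ1 (fun _ => norm_nonneg _) hδ fun t => ?_
    rw [Nat.mul_succ]
    exact (hcmp t N le_rfl).trans (add_le_add_left (hγ _ (fun k => hu _) _ (hA _)) _)
  have hdiv : Tendsto (fun k : ℕ => k / N) atTop atTop := 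
    tendsto_atTop_atTop.2 fun b => ⟨b * N, fun a ha => (Nat.le_div_iff_mul_le hN).2 ha⟩
  refine squeeze_zero (fun _ => norm_nonneg _) (fun k => ?_)
    (by simpa using (ha.comp hdiv).add (hδ.comp hdiv))
  have h := hcmp (k / N) (k % N) (Nat.mod_lt _ hN).le
  rw [Nat.div_add_mod] at h
  exact h.trans (add_le_add_left (norm_jacobiIter_le hI (fun k => hu _) _ _) _)

/-! ### Cyclic strategies -/

section

variable {O : List (Fin n × Fin n)} {I : ℕ → Fin n × Fin n}

lemma IsCyclicStrategy.mem (hI : IsCyclicStrategy O I) (k : ℕ) : I k ∈ O :=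
  List.mem_of_getElem? (hI k)

lemma IsCyclicStrategy.length_pos (hI : IsCyclicStrategy O I) : 0 < O.length :=
  List.length_pos_of_mem (hI.mem 0)

lemma IsCyclicStrategy.mul_length_add (hI : IsCyclicStrategy O I) (m k : ℕ) :
    I (m * O.length + k) = I k := by
  have h := hI (m * O.length + k)
  rw [Nat.mul_add_mod_self_right, hI k] at h
  exact (Option.some.inj h).symm

lemma IsCyclicStrategy.map_range (hI : IsCyclicStrategy O I) (m : ℕ) :
    (List.range (m * O.length)).map I = (List.replicate m O).flatten := by
  have hO : (List.range O.length).map I = O := by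
    refine List.ext_getElem (by simp) fun k h1 h2 => ?_
    have h := hI k
    rw [Nat.mod_eq_of_lt h2, List.getElem?_eq_getElem h2] at h
    simpa using (Option.some.inj h).symm
  induction m with
  | zero => simp
  | succ m ih =>
    rw [Nat.succ_mul, List.range_add, List.map_append, ih, List.map_map, List.replicate_succ',
      List.flatten_append, List.flatten_singleton]
    congr 1
    conv_rhs => rw [← hO]
    exact List.map_congr_left fun k _ => hI.mul_length_add m k

end

end JacobiPivot

theorem proposition4p3 (n : ℕ)
    (O : List (Fin n × Fin n)) (hO : O ∈ JacobiPivot.generalizedSerial n)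
    (I : ℕ → Fin n × Fin n) (hI : JacobiPivot.IsCyclicStrategy O I)
    (α φ : ℕ → ℝ) (hφ : ∀ k, |φ k| ≤ Real.pi / 4)
    (R : ℕ → Matrix (Fin n) (Fin n) ℂ)
    (hR : ∀ k, R k = JacobiPivot.planeRotation (I k).1 (I k).2 (α k) (φ k))
    (M : ℕ → Matrix (Fin n) (Fin n) ℂ) (hM : ∀ k, (M k).IsHermitian)
    (hoffM : Tendsto (fun k => JacobiPivot.off (M k)) atTop (𝓝 0))
    (H₀ : Matrix (Fin n) (Fin n) ℂ) (hH₀ : H₀.IsHermitian)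
    (H : ℕ → Matrix (Fin n) (Fin n) ℂ) (hinit : H 0 = H₀)
    (hstep : ∀ k, H (k + 1) = (R k).conjTranspose * H k * R k + M k)
    (hpivot : Tendsto (fun k => ‖H (k + 1) (I k).1 (I k).2‖) atTop (𝓝 0)) :
    Tendsto (fun k => JacobiPivot.off (H k)) atTop (𝓝 0) := by
  open JacobiPivot in
  have hherm : ∀ k, (H k).IsHermitian := by
    intro k
    induction k with
    | zero => rwa [hinit]
    | succ k ih => rw [hstep]; exact (Matrix.isHermitian_conjTranspose_mul_mul _ ih).add (hM k)
  have hne : ∀ k, (I k).1 ≠ (I k).2 := fun k => (hO.1.1 _ (hI.mem k)).ne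
  set u : ℕ → ℝ × ℂ := fun k =>
    (Real.cos (φ k), Complex.exp (Complex.I * α k) * (Real.sin (φ k) : ℂ)) with hu_def
  have hu : ∀ k, u k ∈ angleParams := fun k => rotation_mem_angleParams (α k) (hφ k)
  have hstep' : ∀ k, H (k + 1) = rotate (I k).1 (I k).2 (u k) (H k) + M k := fun k => by
    rw [hstep, hR, planeRotation_eq_pivotUnitary, rotate]
  obtain ⟨m, hm⟩ := eventuallyForcing_of_mem_generalizedSerial hO
  -- The additional cycle makes the period positive even if `m = 0`.
  have hforce : Forcing ((List.range ((m + 1) * O.length)).map I) := by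
    rw [hI.map_range, List.replicate_succ, List.flatten_cons]
    simpa using hm.append_append O []
  simp only [off_eq_norm]
  refine tendsto_zero_of_periodic hne hu (Nat.mul_pos m.succ_pos hI.length_pos)
    (hI.mul_length_add (m + 1)) hforce (fun k i => by simp [offDiag]) ?_
  refine tendsto_norm_zero_of_entries fun i j => ?_
  refine squeeze_zero_norm (fun k => norm_offDiag_sub_jacobiStep_apply_le (hne k) (hu k)
    (hherm (k + 1)) (hstep' k) i j) ?_
  simpa using hoffM.add hpivot
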